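/- Let $q$ be a prime power, let $n,r\ge 1$ be integers and let $E$ be an $n$-dimensional vector space over $\mathbb F_q$. A $(q,r)$-polymatroid $M=(V,\rho)$ on a finite-dimensional $\mathbb F_q$-space $V$ is a function $\rho$ from the subspaces of $V$ to the non-negative integers such that $\rho(A)\le r\dim A$, such that $A\le B$ implies $\rho(A)\le\rho(B)$, and such that $\rho(A+B)+\rho(A\cap B)\le\rho(A)+\rho(B)$. For $T\le V$, the contraction $M/T$ is the $(q,r)$-polymatroid on $V/T$ with rank function $A/T\mapsto\rho(A)-\rho(T)$. Fix on each space $V$ considered an involutive anti-isomorphism $U\mapsto U^\perp$ of its subspace lattice (for example, orthogonal complement with respect to a nondegenerate symmetric bilinear form). The dual $M^*$ has rank function $\rho^*(A)=r\dim A-\rho(V)+\rho(A^\perp)$, and for $X\le V$ we put $M.X:=M/X^\perp$. A subspace $A$ is independent in $M$ if $\rho(A)=r\dim A$ and dependent otherwise; a circuit is a minimal dependent subspace; a cocircuit of $M$ is a circuit of $M^*$; and $d_M$ is the minimum dimension of a cocircuit of $M$. With $\mu$ the Möbius function of the subspace lattice of $V$, let $$p(M;z)=\sum_{X\le V}\mu(0,X)\,z^{\rho(V)-\rho(X)}\in\mathbb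 Z[z],\qquad A_M(i;z)=\sum_{X\le V,\ \dim X=i}p(M.X;z).$$ Let $M$ be a $(q,r)$-polymatroid on $E$, let $\mathbb F$ be a field, and let $\theta\in\mathbb F$ satisfy $\theta^s\ne1$ for all $s\in\{1,\dots,r\}$. Let $t$ be an integer with $1\le t<d_M$. Assume that $q\neq 0$ in $\mathbb F$ and that $1+q+\dots+q^{i-1}\ne0$ in $\mathbb F$ for $1\le i\le n-t$ (both are automatic if $\mathbb F$ has characteristic $0$). Suppose that $$\bigl|\{\,j\in\{1,\dots,n-t\}: A_{M^*}(j;\theta)\neq0\,\}\bigr|\le d_M-t,$$ and that for every $t$-dimensional subspace $T\le E$ and every $0\le j\le n-t$, if $A_{M^*}(j;\theta)=0$ then $A_{M^*/T}(j;\theta)=0$. Then for each $j\in\{d_{M^*},\dots,n-t\}$, the $j$-dimensional subspaces $X\le E$ with $p(M^*.X;\theta)\ne0$ are the blocks of a weighted $t$-design over $\mathbb F_q$ with weight function $f^*(X)=p(M^*.X;\theta)$. That is, there is $\lambda\in\mathbb F$ such that for every $t$-dimensional subspace $T\le E$, $$\sum_{\substack{T\le X\le E,\ \dim X=j\\ p(M^*.X;\theta)\ne0}}p(M^*.X;\theta)=\lambda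 .$$ -/

import Mathlib

open scoped Classical Polynomial

noncomputable section

namespace QPoly

section Lattice

variable (K V : Type*) [Field K] [Finite K] [AddCommGroup V] [Module K V] [FiniteDimensional K V]

/-- A finite-dimensional space over a finite field has finitely many subspaces. -/
instance instFintypeSubspace : Fintype (Submodule K V) :=
  haveI : Finite V := Module.finite_of_finite K
  Fintype.ofFinite _

/-- The subspace lattice as a locally finite order, so that its Möbius function
`IncidenceAlgebra.mu` is available. -/
instance instLocallyFiniteOrderSubspace : LocallyFiniteOrder (Submodule K V) :=
  Fintype.toLocallyFiniteOrder

end Lattice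

/-- An involutive anti-isomorphism `U ↦ U^⊥` of the lattice of subspaces of `V`
(an order-reversing involution is a lattice anti-isomorphism). -/
structure SubspaceDuality (K V : Type*) [Field K] [AddCommGroup V] [Module K V] where
  perp : Submodule K V → Submodule K V
  involutive : ∀ U, perp (perp U) = U
  antitone : ∀ U W, U ≤ W → perp W ≤ perp U

/-- A `(q,r)`-polymatroid on the space `V` over the finite field `K` with `q` elements. -/
structure QPolymatroid (K V : Type*) [Field K] [AddCommGroup V] [Module K V] (r : ℕ) where
  rank : Submodule K V → ℕ
  rank_le : ∀ A, rank A ≤ r * Module.finrank K A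
  rank_mono : ∀ A B, A ≤ B → rank A ≤ rank B
  rank_submod : ∀ A B, rank (A ⊔ B) + rank (A ⊓ B) ≤ rank A + rank B

variable {K V : Type*} [Field K] [AddCommGroup V] [Module K V]

namespace SubspaceDuality

variable (D : SubspaceDuality K V)

/-- The duality as an order isomorphism onto the order dual. -/
def orderIso : Submodule K V ≃o (Submodule K V)ᵒᵈ where
  toFun U := OrderDual.toDual (D.perp U)
  invFun U := D.perp (OrderDual.ofDual U)
  left_inv U := D.involutive U
  right_inv U := D.involutive U
  map_rel_iff' := by
    intro U W
    refine ⟨fun h => ?_, fun h => D.antitone U W h⟩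
    have h2 := D.antitone _ _ (show D.perp W ≤ D.perp U from h)
    rwa [D.involutive, D.involutive] at h2

theorem perp_sup (A B : Submodule K V) : D.perp (A ⊔ B) = D.perp A ⊓ D.perp B :=
  D.orderIso.map_sup A B

theorem perp_inf (A B : Submodule K V) : D.perp (A ⊓ B) = D.perp A ⊔ D.perp B :=
  D.orderIso.map_inf A B

theorem perp_top : D.perp ⊤ = ⊥ := D.orderIso.map_top

theorem finrank_perp_add [FiniteDimensional K V] (U : Submodule K V) :
    Module.finrank K (D.perp U) + Module.finrank K U = Module.finrank K V := by
  have h1 : Order.height (D.perp U) = Order.coheight U := by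
    have h := Order.coheight_orderIso D.orderIso U
    rw [← h]; rfl
  rw [← Module.length_submodule, ← Module.length_quotient, Module.length_eq_finrank,
    Module.length_eq_finrank] at h1
  have h2 : Module.finrank K (D.perp U) = Module.finrank K (V ⧸ U) := by exact_mod_cast h1
  rw [h2]
  exact Submodule.finrank_quotient_add_finrank U

end SubspaceDuality

namespace QPolymatroid

variable {r : ℕ}

/-- Enlarging a space raises the rank by at most `r` times the increase in dimension. -/
theorem rank_add_le [FiniteDimensional K V] (M : QPolymatroid K V r) {A B : Submodule K V}
    (h : A ≤ B) :
    M.rank B + r * Module.finrank K A ≤ M.rank A + r * Module.finrank K B := by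
  obtain ⟨C, hC⟩ := Submodule.exists_isCompl A
  have hsup : A ⊔ (C ⊓ B) = B := by
    rw [← sup_inf_assoc_of_le C h, hC.sup_eq_top, top_inf_eq]
  have hinf : A ⊓ (C ⊓ B) = ⊥ := by
    rw [← inf_assoc, hC.inf_eq_bot, bot_inf_eq]
  have hd := Submodule.finrank_sup_add_finrank_inf_eq A (C ⊓ B)
  rw [hsup, hinf, finrank_bot, add_zero] at hd
  have hs := M.rank_submod A (C ⊓ B)
  rw [hsup] at hs
  have hr := M.rank_le (C ⊓ B)
  rw [hd, mul_add]
  omega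

/-- The dual polymatroid, with rank function `ρ*(A) = r dim A - ρ(V) + ρ(A^⊥)`
(the subtraction below never truncates, see `dual_rank_add`). -/
def dual [FiniteDimensional K V] (D : SubspaceDuality K V) (M : QPolymatroid K V r) :
    QPolymatroid K V r where
  rank A := r * Module.finrank K A + M.rank (D.perp A) - M.rank ⊤
  rank_le A := by
    have := M.rank_mono (D.perp A) ⊤ le_top
    omega
  rank_mono A B h := by
    have h1 := M.rank_add_le (D.antitone A B h)
    have h2 := D.finrank_perp_add A
    have h3 := D.finrank_perp_add B
    have h4 : r * Module.finrank K (D.perp A) + r * Module.finrank K A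
        = r * Module.finrank K (D.perp B) + r * Module.finrank K B := by
      rw [← mul_add, ← mul_add, h2, h3]
    omega
  rank_submod A B := by
    have key : ∀ X : Submodule K V,
        M.rank ⊤ ≤ r * Module.finrank K X + M.rank (D.perp X) := by
      intro X
      have h1 := M.rank_add_le (le_top : D.perp X ≤ ⊤)
      have h2 := D.finrank_perp_add X
      have h4 : r * Module.finrank K (D.perp X) + r * Module.finrank K X
          = r * Module.finrank K (⊤ : Submodule K V) := by
        rw [← mul_add, h2, finrank_top]
      omega
    have k1 := key A
    have k2 := key B
    have k3 := key (A ⊔ B)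
    have k4 := key (A ⊓ B)
    have hs := M.rank_submod (D.perp A) (D.perp B)
    rw [← D.perp_sup, ← D.perp_inf] at hs
    have hd : r * Module.finrank K ↥(A ⊔ B) + r * Module.finrank K ↥(A ⊓ B)
        = r * Module.finrank K A + r * Module.finrank K B := by
      rw [← mul_add, ← mul_add, Submodule.finrank_sup_add_finrank_inf_eq]
    omega

theorem dual_rank_add [FiniteDimensional K V] (D : SubspaceDuality K V) (M : QPolymatroid K V r)
    (A : Submodule K V) :
    (M.dual D).rank A + M.rank ⊤ = r * Module.finrank K A + M.rank (D.perp A) := by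
  have h1 := M.rank_add_le (le_top : D.perp A ≤ ⊤)
  have h2 := D.finrank_perp_add A
  have h4 : r * Module.finrank K (D.perp A) + r * Module.finrank K A
      = r * Module.finrank K (⊤ : Submodule K V) := by
    rw [← mul_add, h2, finrank_top]
  show r * Module.finrank K A + M.rank (D.perp A) - M.rank ⊤ + M.rank ⊤ = _
  omega

theorem finrank_comap_mkQ [FiniteDimensional K V] (T : Submodule K V)
    (A : Submodule K (V ⧸ T)) :
    Module.finrank K (A.comap T.mkQ) = Module.finrank K A + Module.finrank K T := by
  have hT : T ≤ A.comap T.mkQ := Submodule.le_comap_mkQ T A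
  have h1 := Submodule.finrank_quotient_add_finrank (A.comap T.mkQ)
  have h2 := Submodule.finrank_quotient_add_finrank A
  have h3 := Submodule.finrank_quotient_add_finrank T
  have h4 := (Submodule.quotientQuotientEquivQuotient T (A.comap T.mkQ) hT).finrank_eq
  rw [Submodule.map_comap_eq_of_surjective T.mkQ_surjective] at h4
  omega

/-- The contraction `M/T` of `T` from `M`: the rank of a subspace of `V ⧸ T`, written as `A/T`
with `T ≤ A`, is `ρ(A) - ρ(T)`. -/
def contract [FiniteDimensional K V] (M : QPolymatroid K V r) (T : Submodule K V) :
    QPolymatroid K (V ⧸ T) r where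
  rank A := M.rank (A.comap T.mkQ) - M.rank T
  rank_le A := by
    have h1 := M.rank_add_le (Submodule.le_comap_mkQ T A)
    rw [finrank_comap_mkQ, mul_add] at h1
    omega
  rank_mono A B h := by
    have := M.rank_mono _ _ (Submodule.comap_mono (f := T.mkQ) h)
    omega
  rank_submod A B := by
    have hs := M.rank_submod (A.comap T.mkQ) (B.comap T.mkQ)
    have hsup : A.comap T.mkQ ⊔ B.comap T.mkQ = (A ⊔ B).comap T.mkQ := by
      have h : A ⊔ B = (A.comap T.mkQ ⊔ B.comap T.mkQ).map T.mkQ := by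
        rw [Submodule.map_sup, Submodule.map_comap_eq_of_surjective T.mkQ_surjective,
          Submodule.map_comap_eq_of_surjective T.mkQ_surjective]
      rw [h, Submodule.comap_map_mkQ]
      exact (sup_eq_right.2 (le_sup_of_le_left (Submodule.le_comap_mkQ T A))).symm
    rw [hsup, ← Submodule.comap_inf] at hs
    have a1 := M.rank_mono _ _ (Submodule.le_comap_mkQ T A)
    have a2 := M.rank_mono _ _ (Submodule.le_comap_mkQ T B)
    have a3 := M.rank_mono _ _ (Submodule.le_comap_mkQ T (A ⊔ B))
    have a4 := M.rank_mono _ _ (Submodule.le_comap_mkQ T (A ⊓ B))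
    omega

/-- The contraction `M.X = M/X^⊥` of `M` to `X`. -/
def contractTo [FiniteDimensional K V] (D : SubspaceDuality K V) (M : QPolymatroid K V r)
    (X : Submodule K V) : QPolymatroid K (V ⧸ D.perp X) r :=
  M.contract (D.perp X)

/-- `ℓ_M(A) = ρ(V) - ρ(A)`, a natural number by monotonicity of the rank. -/
def ell (M : QPolymatroid K V r) (A : Submodule K V) : ℕ :=
  M.rank ⊤ - M.rank A

/-- A subspace is independent if its rank is `r` times its dimension. -/
def Indep (M : QPolymatroid K V r) (A : Submodule K V) : Prop :=
  M.rank A = r * Module.finrank K A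

/-- A circuit is an inclusion-minimal dependent subspace. -/
def IsCircuit (M : QPolymatroid K V r) (C : Submodule K V) : Prop :=
  Minimal (fun A => ¬ M.Indep A) C

/-- A cocircuit of `M` is a circuit of the dual of `M`. -/
def IsCocircuit [FiniteDimensional K V] (D : SubspaceDuality K V) (M : QPolymatroid K V r)
    (C : Submodule K V) : Prop :=
  (M.dual D).IsCircuit C

/-- `d_M`, the least dimension of a cocircuit of `M` (with value `0` if there is none). -/
def minCocircuitDim [FiniteDimensional K V] (D : SubspaceDuality K V) (M : QPolymatroid K V r) :
    ℕ :=
  sInf {d | ∃ C : Submodule K V, M.IsCocircuit D C ∧ Module.finrank K C = d}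

variable [Finite K] [FiniteDimensional K V]

/-- The characteristic polynomial `p(M;z) = ∑_X μ(0,X) z^{ℓ(X)}`. -/
def charPoly (M : QPolymatroid K V r) : ℤ[X] :=
  ∑ A : Submodule K V,
    Polynomial.C (IncidenceAlgebra.mu ℤ (⊥ : Submodule K V) A) * Polynomial.X ^ M.ell A

/-- The weight enumerator `A_M(i;z)`: the sum of `p(M.X;z)` over all `X` of dimension `i`. -/
def weightEnum (D : SubspaceDuality K V) (M : QPolymatroid K V r) (i : ℕ) : ℤ[X] :=
  ∑ A ∈ Finset.univ.filter (fun A : Submodule K V => Module.finrank K A = i),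
    (M.contractTo D A).charPoly

variable {F : Type*} [Field F]

/-- The weight `p(M.X;θ)` of the subspace `X`. -/
def weight (D : SubspaceDuality K V) (M : QPolymatroid K V r) (θ : F) (A : Submodule K V) : F :=
  Polynomial.aeval θ (M.contractTo D A).charPoly

/-- `D_M(i;θ)`: the subspaces `X` of dimension `i` with `p(M.X;θ) ≠ 0`. -/
def blocks (D : SubspaceDuality K V) (M : QPolymatroid K V r) (i : ℕ) (θ : F) :
    Finset (Submodule K V) :=
  {A | Module.finrank K A = i ∧ M.weight D θ A ≠ 0}

/-- `R_M(t;θ)`: the `j ∈ {1, …, n - t}` with `A_{M*}(j;θ) ≠ 0`, where `n = dim V`. -/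
def dualSupport (D : SubspaceDuality K V) (M : QPolymatroid K V r) (t : ℕ) (θ : F) : Finset ℕ :=
  {j ∈ Finset.Icc 1 (Module.finrank K V - t) |
    Polynomial.aeval θ ((M.dual D).weightEnum D j) ≠ 0}

end QPolymatroid

/-- `(V, B, f)` is a weighted `t`-`(n,k,lam;q)` design, where `n = dim V`: all blocks have
dimension `k`, and for each `t`-dimensional `T` the weights of the blocks containing `T` sum to
`lam`. Only the values of `f` on `B` matter. -/
structure IsWeightedDesign [Finite K] [FiniteDimensional K V] {G : Type*} [AddCommGroup G]
    (t k : ℕ) (lam : G) (B : Finset (Submodule K V)) (f : Submodule K V → G) : Prop where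
  t_pos : 0 < t
  k_pos : 0 < k
  finrank_eq : ∀ X ∈ B, Module.finrank K X = k
  sum_eq : ∀ T : Submodule K V, Module.finrank K T = t → ∑ X ∈ B with T ≤ X, f X = lam

end QPoly

end

/-!
Write `N = M*` and attach to each subspace `S` of `E` the weight `φ S = p(N/S; θ)`, so that the
weight of a block `X` is `φ (X^⊥)`. Möbius inversion (`sum_charPoly_contract`) gives
`∑_{S ≥ T} φ S = θ ^ ℓ_N(T)`. A space `T` of dimension less than `d_M` contains no cocircuit of `M`,
so it is independent in `N`, and the right-hand side depends only on `dim T`.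

Let `h_k(T)` be the sum of `φ` over the `k`-dimensional spaces above `T`; for `dim T = t` it is
the weight enumerator of `M*/T` at `n - k` (`aeval_weightEnum_contract`). Summing `h_k` over the
covers of `T` multiplies it by the `q`-integer `[k - dim T]` (`sum_coversIn_intervalSum_self`), because
a vector space of dimension `m` has `[m]` lines. Summing the inversion formula repeatedly over covers
therefore shows that `∑_k [k - t] [k - t - 1] ⋯ [k - t - i + 1] h_k(T)` is the same for all
`t`-spaces `T` as long as `i < d_M - t` (`exists_moment_eq`). By the hypotheses on the weight
enumerators at most `d_M - t` of the `h_k(T)` with `k < n` can be nonzero, and the coefficients are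
Newton polynomials in the distinct numbers `[k - t]`, so these equations determine `h_k(T)`; hence
`h_k(T)` does not depend on `T` (`intervalSum_top_eq`). This is the Assmus–Mattson argument.

So the spaces `X^⊥` of dimension `k = n - j` form a weighted `t`-design. The dual of a weighted
`t`-design is one too: by induction on the codimension of `H`, the sum of `φ` over the `k`-spaces
between `A` and `H` depends only on `dim A` and `dim H` when `dim A + codim H ≤ t`
(`exists_intervalSum_eq`); the induction divides only by powers of `q`. With `A = 0` and `H = T^⊥`
this is the claim.
-/

namespace QPoly

/-! ### Counting covers in the subspace lattice -/

section Counting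

variable {K V : Type*} [Field K] [Finite K] [AddCommGroup V] [Module K V] [FiniteDimensional K V]

/-- The subspaces of `S` that contain `A` with codimension one. -/
noncomputable def coversIn (A S : Submodule K V) : Finset (Submodule K V) :=
  {B | A ≤ B ∧ B ≤ S ∧ Module.finrank K B = Module.finrank K A + 1}

theorem mem_coversIn {A S B : Submodule K V} :
    B ∈ coversIn A S ↔ A ≤ B ∧ B ≤ S ∧ Module.finrank K B = Module.finrank K A + 1 := by
  simp [coversIn]

omit [FiniteDimensional K V] in
theorem card_filter_mem_diff [Fintype V] {A S : Submodule K V} (h : A ≤ S) :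
    (Finset.univ.filter (fun v : V => v ∈ S ∧ v ∉ A)).card + Nat.card K ^ Module.finrank K A =
      Nat.card K ^ Module.finrank K S := by
  have hc : ∀ B : Submodule K V, (Finset.univ.filter (fun v : V => v ∈ B)).card =
      Nat.card K ^ Module.finrank K B := by
    intro B
    let _ : Fintype K := Fintype.ofFinite K
    rw [Nat.card_eq_fintype_card, ← Module.card_eq_pow_finrank (K := K) (V := B),
      Fintype.card_subtype]
  rw [← hc A, ← hc S, ← Finset.card_union_of_disjoint]
  · congr 1
    ext v
    simp only [Finset.mem_union, Finset.mem_filter, Finset.mem_univ, true_and]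
    have := @h v
    tauto
  · rw [Finset.disjoint_left]
    simp only [Finset.mem_filter, Finset.mem_univ, true_and]
    tauto

theorem sup_span_mem_coversIn {A S : Submodule K V} (h : A ≤ S) {v : V} (hv : v ∈ S)
    (hvA : v ∉ A) : A ⊔ Submodule.span K {v} ∈ coversIn A S := by
  have hv0 : v ≠ 0 := fun h0 => hvA (h0 ▸ A.zero_mem)
  refine mem_coversIn.2 ⟨le_sup_left, sup_le h (by simpa using hv), ?_⟩
  have hinf : A ⊓ Submodule.span K {v} = ⊥ :=
    disjoint_iff.1 ((Submodule.disjoint_span_singleton' hv0).2 hvA)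
  have := Submodule.finrank_sup_add_finrank_inf_eq A (Submodule.span K {v})
  rw [hinf, finrank_bot, finrank_span_singleton hv0] at this
  simpa using this

/-- There are `1 + q + ⋯ + q ^ (m - 1)` covers of `A` inside a space that exceeds `A` by `m`
dimensions: each vector of `S` outside `A` lies in exactly one of them. -/
theorem card_coversIn {A S : Submodule K V} (h : A ≤ S) :
    (coversIn A S).card =
      ∑ k ∈ Finset.range (Module.finrank K S - Module.finrank K A), Nat.card K ^ k := by
  have : Finite V := Module.finite_of_finite K
  let _ : Fintype V := Fintype.ofFinite V
  have hq : 1 < Nat.card K := Finite.one_lt_card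
  have hfib := Finset.card_eq_sum_card_fiberwise
    (s := Finset.univ.filter (fun v : V => v ∈ S ∧ v ∉ A)) (t := coversIn A S)
    (f := fun v => A ⊔ Submodule.span K {v})
    (by
      intro v hv
      simp only [Finset.coe_filter, Finset.mem_univ, true_and, Set.mem_ofPred_eq] at hv
      exact sup_span_mem_coversIn h hv.1 hv.2)
  have hS := card_filter_mem_diff h
  have hconst : ∀ B ∈ coversIn A S,
      ((Finset.univ.filter (fun v : V => v ∈ S ∧ v ∉ A)).filter
        (fun v => A ⊔ Submodule.span K {v} = B)).card =
      Nat.card K ^ Module.finrank K A * (Nat.card K - 1) := by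
    intro B hB
    obtain ⟨hAB, hBS, hd⟩ := mem_coversIn.1 hB
    have hB' := card_filter_mem_diff hAB
    have : (Finset.univ.filter (fun v : V => v ∈ S ∧ v ∉ A)).filter
        (fun v => A ⊔ Submodule.span K {v} = B) =
        Finset.univ.filter (fun v : V => v ∈ B ∧ v ∉ A) := by
      ext v
      simp only [Finset.mem_filter, Finset.mem_univ, true_and]
      constructor
      · rintro ⟨⟨_, h2⟩, rfl⟩
        exact ⟨Submodule.mem_sup_right (Submodule.mem_span_singleton_self v), h2⟩
      · rintro ⟨h1, h2⟩
        refine ⟨⟨hBS h1, h2⟩, Submodule.eq_of_le_of_finrank_eq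
          (sup_le hAB (by simpa using h1)) ?_⟩
        rw [(mem_coversIn.1 (sup_span_mem_coversIn hAB h1 h2)).2.2, hd]
    rw [this, Nat.mul_sub, mul_one, ← pow_succ, ← hd]
    omega
  rw [Finset.sum_congr rfl hconst, Finset.sum_const, smul_eq_mul] at hfib
  have hle : Module.finrank K A ≤ Module.finrank K S := Submodule.finrank_mono h
  have hgeo := Nat.geomSum_eq hq (Module.finrank K S - Module.finrank K A)
  have hmul : (∑ k ∈ Finset.range (Module.finrank K S - Module.finrank K A), Nat.card K ^ k) *
      (Nat.card K - 1) = Nat.card K ^ (Module.finrank K S - Module.finrank K A) - 1 := by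
    have := geom_sum_mul_add (Nat.card K - 1) (Module.finrank K S - Module.finrank K A)
    rw [Nat.sub_add_cancel hq.le] at this
    omega
  have hpos : 0 < Nat.card K ^ Module.finrank K A * (Nat.card K - 1) :=
    Nat.mul_pos (pow_pos (by omega) _) (by omega)
  apply Nat.eq_of_mul_eq_mul_right hpos
  rw [← hfib, mul_left_comm, hmul, Nat.mul_sub, mul_one, ← pow_add,
    Nat.add_sub_cancel' hle]
  omega

end Counting

/-! ### Möbius inversion for contractions -/

/-- The Möbius function of an interval is computed inside any upper set containing it. -/
theorem mu_map_of_upperSet {R α β : Type*} [Ring R] [PartialOrder α] [PartialOrder β]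
    [LocallyFiniteOrder α] [LocallyFiniteOrder β] [DecidableEq α] [DecidableEq β] [Finite α]
    (f : α ↪o β) (hf : ∀ x y, f x ≤ y → ∃ z, f z = y) (a b : α) :
    IncidenceAlgebra.mu R (f a) (f b) = IncidenceAlgebra.mu R a b := by
  induction b using WellFoundedLT.induction with
  | ind b ih =>
    by_cases hab : a = b
    · subst hab; simp
    · rw [IncidenceAlgebra.mu_eq_neg_sum_Ico_of_ne hab,
        IncidenceAlgebra.mu_eq_neg_sum_Ico_of_ne (f.injective.ne hab)]
      congr 1
      have : Finset.Ico (f a) (f b) = (Finset.Ico a b).map f.toEmbedding := by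
        ext y
        simp only [Finset.mem_Ico, Finset.mem_map, RelEmbedding.coe_toEmbedding]
        constructor
        · rintro ⟨h1, h2⟩
          obtain ⟨z, rfl⟩ := hf _ _ h1
          exact ⟨z, ⟨f.le_iff_le.1 h1, f.lt_iff_lt.1 h2⟩, rfl⟩
        · rintro ⟨z, ⟨h1, h2⟩, rfl⟩
          exact ⟨f.le_iff_le.2 h1, f.lt_iff_lt.2 h2⟩
      rw [this, Finset.sum_map]
      exact Finset.sum_congr rfl fun x hx => ih x (Finset.mem_Ico.1 hx).2

namespace QPolymatroid

variable {K V : Type*} [Field K] [Finite K] [AddCommGroup V] [Module K V] [FiniteDimensional K V]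
variable {r : ℕ}

theorem mu_comap_mkQ (T : Submodule K V) (A B : Submodule K (V ⧸ T)) :
    IncidenceAlgebra.mu ℤ (A.comap T.mkQ) (B.comap T.mkQ) = IncidenceAlgebra.mu ℤ A B :=
  mu_map_of_upperSet (Submodule.comapMkQOrderEmbedding T) (fun x y hxy =>
    ⟨y.map T.mkQ, by
      have : T ≤ y := (Submodule.le_comap_mkQ T x).trans hxy
      simpa [Submodule.comap_map_mkQ] using this⟩) A B

/-- Subspaces of `V ⧸ T` correspond to subspaces of `V` containing `T`. -/
theorem sum_comap_mkQ {G : Type*} [AddCommMonoid G] (T : Submodule K V)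
    (P : Submodule K V → Prop) [DecidablePred P] (g : Submodule K V → G) :
    ∑ A : Submodule K (V ⧸ T) with P (A.comap T.mkQ), g (A.comap T.mkQ) =
      ∑ A : Submodule K V with T ≤ A ∧ P A, g A := by
  refine Finset.sum_bij (fun A _ => A.comap T.mkQ) ?_ ?_ ?_ ?_
  · intro A hA
    simp only [Finset.mem_filter, Finset.mem_univ, true_and] at hA ⊢
    exact ⟨Submodule.le_comap_mkQ T A, hA⟩
  · intro A _ B _ h
    exact Submodule.comap_injective_of_surjective T.mkQ_surjective h
  · intro A hA
    simp only [Finset.mem_filter, Finset.mem_univ, true_and] at hA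
    have : (A.map T.mkQ).comap T.mkQ = A := by
      simpa [Submodule.comap_map_mkQ] using hA.1
    exact ⟨A.map T.mkQ, by simpa [this] using hA.2, this⟩
  · intros; rfl

theorem charPoly_contract (M : QPolymatroid K V r) (T : Submodule K V) :
    (M.contract T).charPoly = ∑ A : Submodule K V with T ≤ A,
      Polynomial.C (IncidenceAlgebra.mu ℤ T A) * Polynomial.X ^ M.ell A := by
  have h := sum_comap_mkQ T (fun _ => True) (fun A =>
    Polynomial.C (IncidenceAlgebra.mu ℤ T A) * (Polynomial.X : ℤ[X]) ^ M.ell A)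
  simp only [and_true, Finset.filter_true] at h
  rw [← h, charPoly]
  refine Finset.sum_congr rfl fun A _ => ?_
  have hbot : (⊥ : Submodule K (V ⧸ T)).comap T.mkQ = T := by simp
  rw [← mu_comap_mkQ, hbot]
  congr 2
  have h1 := M.rank_mono _ _ (Submodule.le_comap_mkQ T A)
  show M.rank (Submodule.comap T.mkQ ⊤) - M.rank T - (M.rank (A.comap T.mkQ) - M.rank T) =
    M.rank ⊤ - M.rank (A.comap T.mkQ)
  rw [Submodule.comap_top]
  omega

/-- Iterated contraction is contraction by the preimage. -/
theorem charPoly_contract_contract (M : QPolymatroid K V r) (T : Submodule K V)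
    (Y : Submodule K (V ⧸ T)) :
    ((M.contract T).contract Y).charPoly = (M.contract (Y.comap T.mkQ)).charPoly := by
  rw [charPoly_contract, charPoly_contract]
  have h := sum_comap_mkQ T (fun A => Y.comap T.mkQ ≤ A) (fun A =>
    Polynomial.C (IncidenceAlgebra.mu ℤ (Y.comap T.mkQ) A) * (Polynomial.X : ℤ[X]) ^ M.ell A)
  have hf : (Finset.univ.filter fun A : Submodule K V => T ≤ A ∧ Y.comap T.mkQ ≤ A) =
      Finset.univ.filter fun A : Submodule K V => Y.comap T.mkQ ≤ A := by
    refine Finset.filter_congr fun A _ => ⟨fun h => h.2, fun h => ⟨?_, h⟩⟩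
    exact (Submodule.le_comap_mkQ T Y).trans h
  rw [hf] at h
  rw [← h]
  refine Finset.sum_congr ?_ fun A _ => ?_
  · refine Finset.filter_congr fun A _ => ?_
    exact (Submodule.comapMkQOrderEmbedding T).le_iff_le.symm
  · rw [mu_comap_mkQ]
    congr 2
    have h1 := M.rank_mono _ _ (Submodule.le_comap_mkQ T A)
    show M.rank (Submodule.comap T.mkQ ⊤) - M.rank T - (M.rank (A.comap T.mkQ) - M.rank T) =
      M.rank ⊤ - M.rank (A.comap T.mkQ)
    rw [Submodule.comap_top]
    omega

/-- Möbius inversion: the characteristic polynomials of the contractions `M/S` with `T ≤ S` add up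
to a single power of the variable. -/
theorem sum_charPoly_contract (M : QPolymatroid K V r) (T : Submodule K V) :
    ∑ S : Submodule K V with T ≤ S, (M.contract S).charPoly = Polynomial.X ^ M.ell T := by
  simp_rw [charPoly_contract]
  rw [Finset.sum_comm' (t' := Finset.univ.filter fun A => T ≤ A)
    (s' := fun A => Finset.Icc T A) (by
      intro S A
      simp only [Finset.mem_filter, Finset.mem_univ, true_and, Finset.mem_Icc]
      exact ⟨fun h => ⟨h, h.1.trans h.2⟩, fun h => h.1⟩)]
  simp_rw [← Finset.sum_mul, ← map_sum, IncidenceAlgebra.sum_Icc_mu_left]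
  simp [Finset.sum_ite_eq, apply_ite, ite_mul]

end QPolymatroid

/-! ### Weighted sums over intervals of subspaces -/

/-- The `q`-integer `1 + x + ⋯ + x ^ (m - 1)`. -/
def qInt {F : Type*} [Field F] (x : F) (m : ℕ) : F := ∑ k ∈ Finset.range m, x ^ k

theorem qInt_add {F : Type*} [Field F] (x : F) (a b : ℕ) :
    qInt x (a + b) = qInt x a + x ^ a * qInt x b := by
  simp [qInt, Finset.sum_range_add, pow_add, Finset.mul_sum]

section Sums

variable {K V F : Type*} [Field K] [Finite K] [AddCommGroup V] [Module K V]
  [FiniteDimensional K V] [Field F]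

theorem cast_card_coversIn {A S : Submodule K V} (h : A ≤ S) :
    ((coversIn A S).card : F) =
      qInt (Nat.card K : F) (Module.finrank K S - Module.finrank K A) := by
  rw [card_coversIn h, qInt]
  push_cast
  rfl

/-- The sum of `φ S` over the `k`-dimensional subspaces `S` with `A ≤ S ≤ H`. -/
noncomputable def intervalSum (φ : Submodule K V → F) (k : ℕ) (A H : Submodule K V) : F :=
  ∑ S : Submodule K V with A ≤ S ∧ S ≤ H ∧ Module.finrank K S = k, φ S

theorem intervalSum_eq_zero {φ : Submodule K V → F} {k : ℕ} {A H : Submodule K V}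
    (h : k < Module.finrank K A) : intervalSum φ k A H = 0 := by
  refine Finset.sum_eq_zero fun S hS => ?_
  simp only [Finset.mem_filter, Finset.mem_univ, true_and] at hS
  have := Submodule.finrank_mono hS.1
  omega

/-- The only `dim V`-dimensional subspace is `V` itself. -/
theorem intervalSum_finrank {φ : Submodule K V → F} (A : Submodule K V) :
    intervalSum φ (Module.finrank K V) A ⊤ = φ ⊤ := by
  have : (Finset.univ.filter fun S : Submodule K V =>
      A ≤ S ∧ S ≤ ⊤ ∧ Module.finrank K S = Module.finrank K V) = {⊤} := by
    ext S
    simp only [Finset.mem_filter, Finset.mem_univ, true_and, Finset.mem_singleton]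
    constructor
    · rintro ⟨_, _, h⟩
      exact Submodule.eq_top_of_finrank_eq h
    · rintro rfl
      exact ⟨le_top, le_rfl, finrank_top K V⟩
  rw [intervalSum, this, Finset.sum_singleton]

/-- Double counting of the pairs `A ⋖ B ≤ S` with `B ≤ H`. -/
theorem sum_coversIn_intervalSum (φ : Submodule K V → F) (k : ℕ) (A H H' : Submodule K V) :
    ∑ B ∈ coversIn A H, intervalSum φ k B H' =
      ∑ S : Submodule K V with A ≤ S ∧ S ≤ H' ∧ Module.finrank K S = k,
        ((coversIn A (S ⊓ H)).card : F) * φ S := by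
  unfold intervalSum
  rw [Finset.sum_comm' (t' := Finset.univ.filter fun S : Submodule K V =>
      A ≤ S ∧ S ≤ H' ∧ Module.finrank K S = k) (s' := fun S => coversIn A (S ⊓ H)) (by
    intro B S
    simp only [mem_coversIn, Finset.mem_filter, Finset.mem_univ, true_and, le_inf_iff]
    exact ⟨fun h => ⟨⟨h.1.1, ⟨h.2.1, h.1.2.1⟩, h.1.2.2⟩, h.1.1.trans h.2.1, h.2.2⟩,
      fun h => ⟨⟨h.1.1, h.1.2.1.2, h.1.2.2⟩, h.1.2.1.1, h.2.2⟩⟩)]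
  simp

/-- Passing from `A` to its covers multiplies the sums over `k`-dimensional spaces by a
`q`-integer. -/
theorem sum_coversIn_intervalSum_self (φ : Submodule K V → F) (k : ℕ) (A H : Submodule K V) :
    ∑ B ∈ coversIn A H, intervalSum φ k B H =
      qInt (Nat.card K : F) (k - Module.finrank K A) * intervalSum φ k A H := by
  rw [sum_coversIn_intervalSum, intervalSum, Finset.mul_sum]
  refine Finset.sum_congr rfl fun S hS => ?_
  simp only [Finset.mem_filter, Finset.mem_univ, true_and] at hS
  rw [inf_eq_left.2 hS.2.1, cast_card_coversIn hS.1, hS.2.2]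

/-- For a hyperplane `H` of `H'`, the covers of `A` inside `H` separate the spaces `S ≤ H'` that
lie in `H` from those that meet `H` in a hyperplane of `S`. -/
theorem sum_coversIn_intervalSum_of_cover (φ : Submodule K V → F) {k : ℕ}
    {A H H' : Submodule K V} (hAH : A ≤ H) (hHH' : H ≤ H')
    (hdim : Module.finrank K H' = Module.finrank K H + 1) (hk : Module.finrank K A < k) :
    ∑ B ∈ coversIn A H, intervalSum φ k B H' =
      qInt (Nat.card K : F) (k - 1 - Module.finrank K A) * intervalSum φ k A H' +
        (Nat.card K : F) ^ (k - 1 - Module.finrank K A) * intervalSum φ k A H := by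
  have hsub : intervalSum φ k A H =
      ∑ S : Submodule K V with A ≤ S ∧ S ≤ H' ∧ Module.finrank K S = k,
        if S ≤ H then φ S else 0 := by
    rw [intervalSum, ← Finset.sum_filter, Finset.filter_filter]
    refine Finset.sum_congr (Finset.filter_congr fun S _ => ?_) fun _ _ => rfl
    exact ⟨fun h => ⟨⟨h.1, h.2.1.trans hHH', h.2.2⟩, h.2.1⟩, fun h => ⟨h.1.1, h.2, h.1.2.2⟩⟩
  rw [sum_coversIn_intervalSum, hsub, intervalSum, Finset.mul_sum, Finset.mul_sum,
    ← Finset.sum_add_distrib]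
  refine Finset.sum_congr rfl fun S hS => ?_
  simp only [Finset.mem_filter, Finset.mem_univ, true_and] at hS
  obtain ⟨hAS, hSH', hSk⟩ := hS
  rw [cast_card_coversIn (le_inf hAS hAH)]
  split_ifs with h
  · rw [inf_eq_left.2 h, hSk,
      show k - Module.finrank K A = (k - 1 - Module.finrank K A) + 1 by omega, qInt_add]
    simp [qInt]
    ring
  · have h1 := Submodule.finrank_sup_add_finrank_inf_eq S H
    have h2 : Module.finrank K ↥(S ⊔ H) ≤ Module.finrank K H' :=
      Submodule.finrank_mono (sup_le hSH' hHH')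
    have h3 : Module.finrank K H < Module.finrank K ↥(S ⊔ H) :=
      Submodule.finrank_lt_finrank_of_lt (lt_of_le_of_ne le_sup_right fun e =>
        h (e ▸ le_sup_left))
    rw [show Module.finrank K ↥(S ⊓ H) = k - 1 by omega]
    simp

/-! ### Moments over covers -/

/-- If the sum of `φ` over all spaces above `T` depends only on `dim T` when `dim T < d`, then so
do the higher `q`-moments, obtained by summing repeatedly over covers. -/
theorem exists_moment_eq (φ : Submodule K V → F) (d : ℕ) (g : ℕ → F)
    (hg : ∀ T : Submodule K V, Module.finrank K T < d →
      ∑ S : Submodule K V with T ≤ S, φ S = g (Module.finrank K T)) (i : ℕ) :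
    ∃ c : ℕ → F, ∀ T : Submodule K V, Module.finrank K T + i < d →
      ∑ k ∈ Finset.range (Module.finrank K V + 1),
        (∏ l ∈ Finset.range i, qInt (Nat.card K : F) (k - Module.finrank K T - l)) *
          intervalSum φ k T ⊤ = c (Module.finrank K T) := by
  induction i with
  | zero =>
    refine ⟨g, fun T hT => ?_⟩
    rw [← hg T hT, ← Finset.sum_fiberwise_of_maps_to (t := Finset.range (Module.finrank K V + 1))
      (g := fun S : Submodule K V => Module.finrank K S)
      (fun S _ => Finset.mem_range.2 (Nat.lt_succ_of_le S.finrank_le))]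
    refine Finset.sum_congr rfl fun k _ => ?_
    simp [intervalSum, Finset.filter_filter]
  | succ i ih =>
    obtain ⟨c, hc⟩ := ih
    refine ⟨fun m => qInt (Nat.card K : F) (Module.finrank K V - m) * c (m + 1), fun T hT => ?_⟩
    have hsum : ∑ B ∈ coversIn T ⊤, ∑ k ∈ Finset.range (Module.finrank K V + 1),
        (∏ l ∈ Finset.range i, qInt (Nat.card K : F) (k - Module.finrank K B - l)) *
          intervalSum φ k B ⊤ = ∑ B ∈ coversIn T ⊤, c (Module.finrank K T + 1) := by
      refine Finset.sum_congr rfl fun B hB => ?_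
      have hd := (mem_coversIn.1 hB).2.2
      rw [hc B (by omega), hd]
    rw [Finset.sum_const, nsmul_eq_mul, cast_card_coversIn le_top, finrank_top] at hsum
    refine Eq.trans ?_ hsum
    rw [Finset.sum_comm]
    refine Finset.sum_congr rfl fun k _ => ?_
    rw [Finset.prod_range_succ', Nat.sub_zero, mul_assoc, ← sum_coversIn_intervalSum_self,
      Finset.mul_sum]
    refine Finset.sum_congr rfl fun B hB => ?_
    rw [(mem_coversIn.1 hB).2.2]
    congr 1
    refine Finset.prod_congr rfl fun l _ => ?_
    congr 1
    omega

/-- The moment coefficients are, up to a power of `x`, the Newton polynomials in `[m]` with nodes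
`[0], [1], …`. -/
theorem prod_qInt_sub (x : F) (m i : ℕ) :
    ∏ l ∈ Finset.range i, (qInt x m - qInt x l) =
      (∏ l ∈ Finset.range i, x ^ l) * ∏ l ∈ Finset.range i, qInt x (m - l) := by
  rcases le_or_gt i m with h | h
  · rw [← Finset.prod_mul_distrib]
    refine Finset.prod_congr rfl fun l hl => ?_
    have hl' := Finset.mem_range.1 hl
    have := qInt_add x l (m - l)
    rw [Nat.add_sub_cancel' (by omega)] at this
    rw [this]
    ring
  · -- the factor `l = m` vanishes on both sides
    rw [Finset.prod_eq_zero (Finset.mem_range.2 h) (sub_self _),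
      Finset.prod_eq_zero (i := m) (f := fun l => qInt x (m - l)) (Finset.mem_range.2 h)
        (by simp [qInt]), mul_zero]

/-- A weight on finitely many distinct points that kills as many Newton polynomials (with arbitrary
nodes `c`) as there are points is zero. -/
theorem eq_zero_of_sum_newton_eq_zero {ι : Type*} {R : Finset ι} {x : ι → F}
    (hx : Set.InjOn x R) (c : ℕ → F) {δ : ι → F}
    (h : ∀ i < R.card, ∑ j ∈ R, δ j * ∏ l ∈ Finset.range i, (x j - c l) = 0) :
    ∀ j ∈ R, δ j = 0 := by
  -- trade the factors `x j - c l` one by one for factors `x j - x a`; the polynomial vanishing at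
  -- all points but one then isolates the weight of that point
  have key : ∀ s : Finset ι, ∀ i, i + s.card < R.card →
      ∑ j ∈ R, δ j * (∏ l ∈ Finset.range i, (x j - c l)) * ∏ a ∈ s, (x j - x a) = 0 := by
    intro s
    induction s using Finset.induction_on with
    | empty => intro i hi; simpa using h i (by simpa using hi)
    | insert a s ha ih =>
      intro i hi
      rw [Finset.card_insert_of_notMem ha] at hi
      -- write `x j - x a = (x j - c i) + (c i - x a)`
      have h1 := ih (i + 1) (by omega)
      have h2 := ih i (by omega)
      rw [← add_zero (0 : F)]
      nth_rw 1 [← h1]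
      rw [← mul_zero (c i - x a), ← h2, Finset.mul_sum, ← Finset.sum_add_distrib]
      refine Finset.sum_congr rfl fun j _ => ?_
      rw [Finset.prod_insert ha, Finset.prod_range_succ]
      ring
  intro j hj
  have hk := key (R.erase j) 0 (by
    rw [Finset.card_erase_of_mem hj]
    have := Finset.card_pos.2 ⟨j, hj⟩
    omega)
  rw [Finset.sum_eq_single j] at hk
  · simp only [Finset.range_zero, Finset.prod_empty, mul_one, mul_eq_zero] at hk
    refine hk.resolve_right (Finset.prod_ne_zero_iff.2 fun a ha => sub_ne_zero.2 fun e => ?_)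
    exact (Finset.mem_erase.1 ha).1 (hx (Finset.mem_erase.1 ha).2 hj e.symm)
  · intro b hb hbj
    rw [Finset.prod_eq_zero (Finset.mem_erase.2 ⟨hbj, hb⟩) (sub_self _), mul_zero]
  · exact fun hn => absurd hj hn

/-- The Assmus–Mattson argument: if few dimensions `k` carry a nonzero sum above a `t`-space, then
the moments determine these sums, which therefore do not depend on the `t`-space. -/
theorem intervalSum_top_eq (φ : Submodule K V → F) {d t : ℕ} (g : ℕ → F)
    (hg : ∀ T : Submodule K V, Module.finrank K T < d →
      ∑ S : Submodule K V with T ≤ S, φ S = g (Module.finrank K T))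
    (hq : (Nat.card K : F) ≠ 0)
    (hqi : ∀ i ∈ Finset.Icc 1 (Module.finrank K V - t), qInt (Nat.card K : F) i ≠ 0)
    (Z : Finset ℕ) (hZ : Z ⊆ Finset.Ico t (Module.finrank K V)) (hcard : Z.card ≤ d - t)
    (hvan : ∀ T : Submodule K V, Module.finrank K T = t →
      ∀ k ∈ Finset.Ico t (Module.finrank K V), k ∉ Z → intervalSum φ k T ⊤ = 0)
    {T₁ T₂ : Submodule K V} (h₁ : Module.finrank K T₁ = t) (h₂ : Module.finrank K T₂ = t)
    {k : ℕ} (hk : k ≤ Module.finrank K V) :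
    intervalSum φ k T₁ ⊤ = intervalSum φ k T₂ ⊤ := by
  have hout : ∀ k ≤ Module.finrank K V, k ∉ Z →
      intervalSum φ k T₁ ⊤ - intervalSum φ k T₂ ⊤ = 0 := by
    intro k hk hkZ
    rcases lt_or_ge k t with h | h
    · rw [intervalSum_eq_zero (by omega), intervalSum_eq_zero (by omega), sub_zero]
    rcases hk.eq_or_lt with rfl | h'
    · rw [intervalSum_finrank, intervalSum_finrank, sub_self]
    · rw [hvan _ h₁ k (Finset.mem_Ico.2 ⟨h, h'⟩) hkZ, hvan _ h₂ k (Finset.mem_Ico.2 ⟨h, h'⟩) hkZ,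
        sub_zero]
  by_cases hkZ : k ∈ Z
  swap
  · exact sub_eq_zero.1 (hout k hk hkZ)
  refine sub_eq_zero.1 (eq_zero_of_sum_newton_eq_zero (R := Z)
    (x := fun k => qInt (Nat.card K : F) (k - t)) ?_ (fun l => qInt (Nat.card K : F) l)
    (δ := fun k => intervalSum φ k T₁ ⊤ - intervalSum φ k T₂ ⊤) ?_ k hkZ)
  · have hlt : ∀ a ∈ Z, ∀ b ∈ Z, a < b →
        qInt (Nat.card K : F) (a - t) ≠ qInt (Nat.card K : F) (b - t) := by
      intro a ha b hb hab e
      have ha' := Finset.mem_Ico.1 (hZ ha)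
      have hb' := Finset.mem_Ico.1 (hZ hb)
      have hadd := qInt_add (Nat.card K : F) (a - t) (b - a)
      rw [show a - t + (b - a) = b - t by omega, ← e, left_eq_add, mul_eq_zero] at hadd
      rcases hadd with h | h
      · exact pow_ne_zero _ hq h
      · exact hqi (b - a) (Finset.mem_Icc.2 ⟨by omega, by omega⟩) h
    intro a ha b hb e
    rcases lt_trichotomy a b with h | h | h
    · exact absurd e (hlt a ha b hb h)
    · exact h
    · exact absurd e.symm (hlt b hb a ha h)
  · intro i hi
    obtain ⟨c, hc⟩ := exists_moment_eq φ d g hg i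
    have e₁ := hc T₁ (by omega)
    have e₂ := hc T₂ (by omega)
    rw [h₁] at e₁
    rw [h₂] at e₂
    have e := e₁.trans e₂.symm
    rw [← sub_eq_zero, ← Finset.sum_sub_distrib] at e
    simp_rw [← mul_sub] at e
    rw [← Finset.sum_subset (s₁ := Z)] at e
    · rw [← mul_zero (∏ l ∈ Finset.range i, (Nat.card K : F) ^ l), ← e, Finset.mul_sum]
      refine Finset.sum_congr rfl fun k _ => ?_
      rw [prod_qInt_sub]
      ring
    · intro a ha
      have := Finset.mem_Ico.1 (hZ ha)
      exact Finset.mem_range.2 (by omega)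
    · intro a ha haZ
      rw [hout a (Nat.lt_succ_iff.1 (Finset.mem_range.1 ha)) haZ, mul_zero]

/-! ### Dual subspace designs -/

/-- A weighted `t`-design is a weighted `i`-design for `i ≤ t`, provided the `q`-integers arising
from double counting are invertible. -/
theorem exists_intervalSum_top_eq_of_le (φ : Submodule K V → F) {k t : ℕ}
    (hqi : ∀ i ∈ Finset.Icc 1 k, qInt (Nat.card K : F) i ≠ 0) (htk : t ≤ k) {c : F}
    (hc : ∀ T : Submodule K V, Module.finrank K T = t → intervalSum φ k T ⊤ = c)
    {i : ℕ} (hi : i ≤ t) :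
    ∃ c : F, ∀ T : Submodule K V, Module.finrank K T = i → intervalSum φ k T ⊤ = c := by
  induction hi using Nat.decreasingInduction with
  | self => exact ⟨c, hc⟩
  | of_succ i hit ih =>
    obtain ⟨c', hc'⟩ := ih
    refine ⟨(qInt (Nat.card K : F) (k - i))⁻¹ *
      (qInt (Nat.card K : F) (Module.finrank K V - i) * c'), fun T hT => ?_⟩
    have hne := hqi (k - i) (Finset.mem_Icc.2 ⟨by omega, by omega⟩)
    rw [eq_inv_mul_iff_mul_eq₀ hne, ← hT, ← sum_coversIn_intervalSum_self,
      Finset.sum_congr rfl fun B hB => hc' B (by rw [(mem_coversIn.1 hB).2.2, hT]),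
      Finset.sum_const, nsmul_eq_mul, cast_card_coversIn le_top, finrank_top]

/-- The intersection numbers of a weighted design: the sum over the blocks between `A` and `H`
depends only on the dimension of `A` and the codimension of `H`, as long as these add up to at most
`t`. For `A = ⊥` this says that the dual of a design is a design. -/
theorem exists_intervalSum_eq (φ : Submodule K V → F) {k t : ℕ}
    (hq : (Nat.card K : F) ≠ 0) (htk : t ≤ k)
    (htop : ∀ i ≤ t, ∃ c : F, ∀ T : Submodule K V, Module.finrank K T = i →
      intervalSum φ k T ⊤ = c) (l : ℕ) :
    ∀ i, i + l ≤ t → ∃ c : F, ∀ A H : Submodule K V, A ≤ H → Module.finrank K A = i →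
      Module.finrank K H + l = Module.finrank K V → intervalSum φ k A H = c := by
  induction l with
  | zero =>
    intro i hi
    obtain ⟨c, hc⟩ := htop i hi
    refine ⟨c, fun A H _ hA hH => ?_⟩
    rw [Submodule.eq_top_of_finrank_eq (S := H) (by omega), hc A hA]
  | succ l ih =>
    intro i hi
    obtain ⟨c₁, hc₁⟩ := ih i (by omega)
    obtain ⟨c₂, hc₂⟩ := ih (i + 1) (by omega)
    refine ⟨((Nat.card K : F) ^ (k - 1 - i))⁻¹ *
      (qInt (Nat.card K : F) (Module.finrank K V - (l + 1) - i) * c₂ -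
        qInt (Nat.card K : F) (k - 1 - i) * c₁), fun A H hAH hA hH => ?_⟩
    obtain ⟨v, hv⟩ : ∃ v, v ∉ H := by
      by_contra! hall
      have : H = ⊤ := by ext v; simp [hall v]
      rw [this, finrank_top] at hH
      omega
    obtain ⟨hHH', -, hdim⟩ := mem_coversIn.1
      (sup_span_mem_coversIn (le_top : H ≤ ⊤) Submodule.mem_top hv)
    set H' := H ⊔ Submodule.span K {v}
    have hsum := sum_coversIn_intervalSum_of_cover φ (k := k) hAH hHH' hdim (by omega)
    rw [Finset.sum_congr rfl fun B hB => hc₂ B H' ((mem_coversIn.1 hB).2.1.trans hHH')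
        (by rw [(mem_coversIn.1 hB).2.2, hA]) (by omega),
      Finset.sum_const, nsmul_eq_mul, cast_card_coversIn hAH,
      hc₁ A H' (hAH.trans hHH') hA (by omega), hA,
      show Module.finrank K H = Module.finrank K V - (l + 1) by omega] at hsum
    rw [eq_inv_mul_iff_mul_eq₀ (pow_ne_zero _ hq), hsum]
    ring

end Sums

/-! ### Weights of polymatroids -/

namespace QPolymatroid

section Weights

variable {K V F : Type*} [Field K] [Finite K] [AddCommGroup V] [Module K V]
  [FiniteDimensional K V] [Field F] {r : ℕ}

omit [Finite K] in
/-- Subspaces of dimension less than `d_M` are independent in `M*`. If `M` has no cocircuit then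
`d_M = 0` and there is no such subspace. -/
theorem indep_dual_of_finrank_lt (D : SubspaceDuality K V) (M : QPolymatroid K V r)
    {A : Submodule K V} (h : Module.finrank K A < M.minCocircuitDim D) : (M.dual D).Indep A := by
  by_contra hA
  obtain ⟨C, hCA, hC⟩ :=
    exists_minimal_le_of_wellFoundedLT (fun A => ¬ (M.dual D).Indep A) A hA
  have h1 : M.minCocircuitDim D ≤ Module.finrank K C := Nat.sInf_le ⟨C, hC, rfl⟩
  have h2 := Submodule.finrank_mono hCA
  omega

omit [Finite K] in
theorem minCocircuitDim_le_finrank (D : SubspaceDuality K V) (M : QPolymatroid K V r) :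
    M.minCocircuitDim D ≤ Module.finrank K V := by
  rcases Set.eq_empty_or_nonempty
    {d | ∃ C : Submodule K V, M.IsCocircuit D C ∧ Module.finrank K C = d} with h | h
  · simp [minCocircuitDim, h]
  · obtain ⟨C, -, hC⟩ := Nat.sInf_mem h
    exact hC.symm.trans_le C.finrank_le

omit [Finite K] in
/-- If all lines are independent in `M*`, then `M*` has a cocircuit, and all its cocircuits are
nonzero. -/
theorem minCocircuitDim_dual_pos (D : SubspaceDuality K V) (M : QPolymatroid K V r) (hr : 0 < r)
    (h : 1 < M.minCocircuitDim D) : 0 < (M.dual D).minCocircuitDim D := by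
  rw [Nat.pos_iff_ne_zero, minCocircuitDim, Ne, Nat.sInf_eq_zero]
  rintro (⟨C, hC, hC0⟩ | hempty)
  · have hmin : Minimal (fun A => ¬ ((M.dual D).dual D).Indep A) C := hC
    refine hmin.prop ?_
    have := ((M.dual D).dual D).rank_le C
    simpa [Indep, hC0] using this
  · have hind : ((M.dual D).dual D).Indep ⊤ := by
      by_contra hA
      obtain ⟨C, -, hC⟩ :=
        exists_minimal_le_of_wellFoundedLT (fun A => ¬ ((M.dual D).dual D).Indep A) ⊤ hA
      exact Set.eq_empty_iff_forall_notMem.1 hempty _ ⟨C, hC, rfl⟩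
    -- so `M*` has rank zero, but it contains an independent line
    have htop := (M.dual D).dual_rank_add D ⊤
    have hbot := (M.dual D).rank_le ⊥
    rw [hind, D.perp_top] at htop
    rw [finrank_bot] at hbot
    have hV : 0 < Module.finrank K V := by
      have := M.minCocircuitDim_le_finrank D
      omega
    have := Module.finrank_pos_iff.1 hV
    obtain ⟨v, hv⟩ := exists_ne (0 : V)
    have hline := finrank_span_singleton (K := K) hv
    have hv' := M.indep_dual_of_finrank_lt D (A := Submodule.span K {v}) (by omega)
    have hle := (M.dual D).rank_mono (Submodule.span K {v}) ⊤ le_top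
    rw [hv', hline] at hle
    omega

/-- The weight of the contraction of `S`, as a function of `S`. -/
noncomputable def contractWeight (M : QPolymatroid K V r) (θ : F) (S : Submodule K V) : F :=
  Polynomial.aeval θ (M.contract S).charPoly

theorem sum_contractWeight (M : QPolymatroid K V r) (θ : F) (T : Submodule K V) :
    ∑ S : Submodule K V with T ≤ S, M.contractWeight θ S = θ ^ M.ell T := by
  simp only [contractWeight, ← map_sum, sum_charPoly_contract, map_pow, Polynomial.aeval_X]

omit [Finite K] [FiniteDimensional K V] in
theorem ell_of_indep {M : QPolymatroid K V r} {T : Submodule K V} (h : M.Indep T) :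
    M.ell T = M.rank ⊤ - r * Module.finrank K T := by
  rw [ell, h]

/-- Reindexing a sum by the duality. -/
theorem sum_perp {G : Type*} [AddCommMonoid G] (D : SubspaceDuality K V)
    (P : Submodule K V → Prop) [DecidablePred P] (g : Submodule K V → G) :
    ∑ X : Submodule K V with P (D.perp X), g (D.perp X) = ∑ S : Submodule K V with P S, g S := by
  refine Finset.sum_nbij' D.perp D.perp ?_ ?_ ?_ ?_ ?_ <;> simp [D.involutive]

theorem aeval_weightEnum (D : SubspaceDuality K V) (M : QPolymatroid K V r) (θ : F) (j : ℕ) :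
    Polynomial.aeval θ (M.weightEnum D j) =
      ∑ S ∈ Finset.univ.filter (fun S : Submodule K V =>
        Module.finrank K S + j = Module.finrank K V), M.contractWeight θ S := by
  rw [weightEnum, map_sum, ← sum_perp D (fun S => Module.finrank K S + j = Module.finrank K V)]
  refine Finset.sum_congr (Finset.filter_congr fun X _ => ?_) fun _ _ => rfl
  have := D.finrank_perp_add X
  omega

/-- The weight enumerator of `M/T` sums the weights of the contractions of the spaces above `T`. -/
theorem aeval_weightEnum_contract (M : QPolymatroid K V r) (T : Submodule K V)
    (D : SubspaceDuality K (V ⧸ T)) (θ : F) (j : ℕ) (hj : j ≤ Module.finrank K V) :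
    Polynomial.aeval θ ((M.contract T).weightEnum D j) =
      intervalSum (M.contractWeight θ) (Module.finrank K V - j) T ⊤ := by
  have h := sum_comap_mkQ T (fun A => Module.finrank K A = Module.finrank K V - j)
    (M.contractWeight θ)
  rw [aeval_weightEnum, intervalSum]
  simp only [le_top, true_and]
  rw [← h]
  refine Finset.sum_congr (Finset.filter_congr fun A _ => ?_) fun A _ => ?_
  · rw [finrank_comap_mkQ]
    have := Submodule.finrank_quotient_add_finrank T
    omega
  · rw [contractWeight, charPoly_contract_contract, contractWeight]

end Weights

end QPolymatroid

end QPoly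

open QPoly QPoly.QPolymatroid in
theorem corollary5p7
    {K E F : Type*} [Field K] [Finite K] [AddCommGroup E] [Module K E] [FiniteDimensional K E]
    [Field F]
    (q n r t : ℕ) (hq : Nat.card K = q) (hn : Module.finrank K E = n) (hn0 : 0 < n) (hr : 0 < r)
    -- `q` and the integers `1 + q + ⋯ + q ^ (i - 1)` are nonzero in `F` (automatic in char. zero)
    (hqF : (q : F) ≠ 0)
    (hqiF : ∀ i ∈ Finset.Icc 1 (n - t), ∑ k ∈ Finset.range i, (q : F) ^ k ≠ 0)
    -- the fixed dualities on `E` and on its quotients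
    (D : QPoly.SubspaceDuality K E)
    (DQ : ∀ T : Submodule K E, QPoly.SubspaceDuality K (E ⧸ T))
    (M : QPoly.QPolymatroid K E r)
    (θ : F) (hθ : ∀ s ∈ Finset.Icc 1 r, θ ^ s ≠ 1)
    (ht : 0 < t) (htd : t < M.minCocircuitDim D)
    (hR : (M.dualSupport D t θ).card ≤ M.minCocircuitDim D - t)
    (hA : ∀ T : Submodule K E, Module.finrank K T = t → ∀ j ≤ n - t,
      Polynomial.aeval θ ((M.dual D).weightEnum D j) = 0 →
      Polynomial.aeval θ (((M.dual D).contract T).weightEnum (DQ T) j) = 0)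
    (j : ℕ) (hj : j ∈ Finset.Icc ((M.dual D).minCocircuitDim D) (n - t)) :
    ∃ lam : F, QPoly.IsWeightedDesign t j lam ((M.dual D).blocks D j θ)
      (fun X => (M.dual D).weight D θ X) := by
  subst hq hn
  have htn : t < Module.finrank K E := htd.trans_le (M.minCocircuitDim_le_finrank D)
  rw [Finset.mem_Icc] at hj
  have hj0 : 0 < j := (M.minCocircuitDim_dual_pos D hr (by omega)).trans_le hj.1
  set φ : Submodule K E → F := (M.dual D).contractWeight θ with hφ
  suffices h : ∃ lam : F, ∀ T : Submodule K E, Module.finrank K T = t →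
      ∑ X : Submodule K E with T ≤ X ∧ Module.finrank K X = j, φ (D.perp X) = lam by
    obtain ⟨lam, hlam⟩ := h
    refine ⟨lam, ht, hj0, fun X hX => ?_, fun T hT => ?_⟩
    · simp only [blocks, Finset.mem_filter, Finset.mem_univ, true_and] at hX
      exact hX.1
    · rw [← hlam T hT, blocks, Finset.filter_filter]
      refine Finset.sum_subset_zero_on_sdiff ?_ ?_ fun _ _ => rfl
      · intro X
        simp only [Finset.mem_filter, Finset.mem_univ, true_and]
        exact fun h => ⟨h.2, h.1.1⟩
      · intro X
        simp only [Finset.mem_sdiff, Finset.mem_filter, Finset.mem_univ, true_and]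
        intro h
        by_contra h0
        exact h.2 ⟨⟨h.1.2, h0⟩, h.1.1⟩
  -- for `j < t` no block contains a `t`-space; for `t ≤ j` all the `q`-integers needed below have
  -- index at most `n - j ≤ n - t`
  rcases lt_or_ge j t with hjt | hjt
  · refine ⟨0, fun T hT => Finset.sum_eq_zero fun X hX => ?_⟩
    simp only [Finset.mem_filter, Finset.mem_univ, true_and] at hX
    have := Submodule.finrank_mono hX.1
    omega
  have htop : ∀ T₁ T₂ : Submodule K E, Module.finrank K T₁ = t → Module.finrank K T₂ = t →
      intervalSum φ (Module.finrank K E - j) T₁ ⊤ =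
        intervalSum φ (Module.finrank K E - j) T₂ ⊤ := by
    intro T₁ T₂ h₁ h₂
    refine intervalSum_top_eq φ (d := M.minCocircuitDim D)
      (fun m => θ ^ ((M.dual D).rank ⊤ - r * m)) (fun T hT => ?_) hqF hqiF
      ((M.dualSupport D t θ).image (Module.finrank K E - ·)) ?_
      (Finset.card_image_le.trans hR) (fun T hT k hk hkZ => ?_) h₁ h₂ (Nat.sub_le _ _)
    · rw [hφ, sum_contractWeight, ell_of_indep (indep_dual_of_finrank_lt D M hT)]
    · intro k hk
      obtain ⟨i, hi, rfl⟩ := Finset.mem_image.1 hk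
      have := Finset.mem_Icc.1 (Finset.mem_filter.1 hi).1
      exact Finset.mem_Ico.2 ⟨by omega, by omega⟩
    · rw [Finset.mem_Ico] at hk
      have hz := hA T hT (Module.finrank K E - k) (by omega) (by
        by_contra h0
        refine hkZ (Finset.mem_image.2 ⟨Module.finrank K E - k, ?_, by omega⟩)
        exact Finset.mem_filter.2 ⟨Finset.mem_Icc.2 ⟨by omega, by omega⟩, h0⟩)
      rwa [aeval_weightEnum_contract _ _ _ _ _ (Nat.sub_le _ _),
        show Module.finrank K E - (Module.finrank K E - k) = k by omega] at hz
  by_cases hex : ∃ T : Submodule K E, Module.finrank K T = t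
  swap
  · exact ⟨0, fun T hT => absurd ⟨T, hT⟩ hex⟩
  obtain ⟨T₀, hT₀⟩ := hex
  obtain ⟨lam, hlam⟩ := exists_intervalSum_eq φ (k := Module.finrank K E - j) hqF (by omega)
    (fun i hi => exists_intervalSum_top_eq_of_le φ
      (fun i hi => hqiF i (by rw [Finset.mem_Icc] at hi ⊢; omega)) (by omega)
      (fun T hT => htop T T₀ hT hT₀) hi) t 0 (by omega)
  -- the blocks above `T` correspond under the duality to the spaces below `T^⊥`
  refine ⟨lam, fun T hT => ?_⟩
  rw [← hlam ⊥ (D.perp T) bot_le (finrank_bot K E) (by rw [← hT]; exact D.finrank_perp_add T),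
    intervalSum, ← sum_perp D (fun S => ⊥ ≤ S ∧ S ≤ D.perp T ∧
      Module.finrank K S = Module.finrank K E - j)]
  refine Finset.sum_congr (Finset.filter_congr fun X _ => ?_) fun _ _ => rfl
  have h1 := D.finrank_perp_add X
  have h2 : D.perp X ≤ D.perp T ↔ T ≤ X :=
    ⟨fun h => by simpa [D.involutive] using D.antitone _ _ h, D.antitone _ _⟩
  rw [h2]
  have h3 : Module.finrank K X ≤ Module.finrank K E := X.finrank_le
  refine ⟨fun h => ⟨bot_le, h.1, by omega⟩, fun h => ⟨h.2.1, by omega⟩⟩
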